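/- Let $(X,d_X)$ be a compact metric space and let $T:X\to X$ be a continuous map such that $(X,T)$ is minimal, i.e. every forward orbit $\{T^n x: n\ge 0\}$ is dense in $X$. Let $\mathcal M^e(X,T)$ be the set of $T$-invariant ergodic Borel probability measures on $X$, and suppose $\#\mathcal M^e(X,T)>1$. Let $d\ge 1$, let $\|\cdot\|$ be the operator norm on real $d\times d$ matrices induced by the Euclidean norm, and equip the space $C(X,GL_d(\mathbb R))$ of continuous maps $X\to GL_d(\mathbb R)$ with the metric $$\rho(A,B)=\max_{x\in X}\{\|A(x)-B(x)\|+\|A(x)^{-1}-B(x)^{-1}\|\}.$$ For $A\in C(X,GL_d(\mathbb R))$ and $n\ge 1$ put $A(n,x)=A(T^{n-1}x)\cdots A(Tx)A(x)$, let $$LI_A=\Big\{x\in X:\ \tfrac1n\log\|A(n,x)\|\text{ does not converge as } n\to\infty\Big\},$$ and let $\mathcal R$ be the set of all $A\in C(X,GL_d(\mathbb R))$ such that $LI_A$ is residual in $X$ (a set is residual if it contains a dense $G_\delta$ set). Then $\mathcal R$ is residual in $C(X,GL_d(\mathbb R))$. If moreover $\mathcal M^e(X,T)$ is finite, then $C(X,GL_d(\mathbb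 R))\setminus\mathcal R$ is nowhere dense in $C(X,GL_d(\mathbb R))$. -/

import Mathlib

open Filter Topology MeasureTheory Matrix
open scoped Matrix.Norms.L2Operator

/-- The metric `ρ(A,B) = max_x (‖A(x) - B(x)‖ + ‖A(x)⁻¹ - B(x)⁻¹‖)` on `C(X, GL_d(ℝ))`, where `‖·‖`
is the operator norm induced by the Euclidean norm. -/
noncomputable def cocycleDist {X : Type*} [TopologicalSpace X] {d : ℕ}
    (A B : C(X, GL (Fin d) ℝ)) : ℝ :=
  ⨆ x : X, (‖(A x : Matrix (Fin d) (Fin d) ℝ) - (B x : Matrix (Fin d) (Fin d) ℝ)‖ +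
    ‖(↑(A x)⁻¹ : Matrix (Fin d) (Fin d) ℝ) - (↑(B x)⁻¹ : Matrix (Fin d) (Fin d) ℝ)‖)

theorem cocycleDist_nonneg {X : Type*} [TopologicalSpace X] {d : ℕ}
    (A B : C(X, GL (Fin d) ℝ)) : 0 ≤ cocycleDist A B :=
  Real.iSup_nonneg fun _ => by positivity

section CocycleMetric

variable {X : Type*} [TopologicalSpace X] [CompactSpace X] {d : ℕ}

theorem cocycleDist_bddAbove (A B : C(X, GL (Fin d) ℝ)) :
    BddAbove (Set.range fun x : X =>
      (‖(A x : Matrix (Fin d) (Fin d) ℝ) - (B x : Matrix (Fin d) (Fin d) ℝ)‖ +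
        ‖(↑(A x)⁻¹ : Matrix (Fin d) (Fin d) ℝ) - (↑(B x)⁻¹ : Matrix (Fin d) (Fin d) ℝ)‖)) := by
  have hA := A.continuous
  have hB := B.continuous
  have h1 : Continuous fun x => (A x : Matrix (Fin d) (Fin d) ℝ) := Units.continuous_val.comp hA
  have h2 : Continuous fun x => (B x : Matrix (Fin d) (Fin d) ℝ) := Units.continuous_val.comp hB
  have h3 : Continuous fun x => (↑(A x)⁻¹ : Matrix (Fin d) (Fin d) ℝ) :=
    Units.continuous_val.comp hA.inv
  have h4 : Continuous fun x => (↑(B x)⁻¹ : Matrix (Fin d) (Fin d) ℝ) :=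
    Units.continuous_val.comp hB.inv
  exact (isCompact_range ((h1.sub h2).norm.add (h3.sub h4).norm)).bddAbove

theorem le_cocycleDist (A B : C(X, GL (Fin d) ℝ)) (x : X) :
    ‖(A x : Matrix (Fin d) (Fin d) ℝ) - (B x : Matrix (Fin d) (Fin d) ℝ)‖ +
      ‖(↑(A x)⁻¹ : Matrix (Fin d) (Fin d) ℝ) - (↑(B x)⁻¹ : Matrix (Fin d) (Fin d) ℝ)‖ ≤
      cocycleDist A B :=
  le_ciSup (cocycleDist_bddAbove A B) x

/-- The map `A ↦ (A, A⁻¹)`. -/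
def cocycleEmbed (A : C(X, GL (Fin d) ℝ)) :
    C(X, Matrix (Fin d) (Fin d) ℝ × (Matrix (Fin d) (Fin d) ℝ)ᵐᵒᵖ) :=
  (ContinuousMap.mk (Units.embedProduct (Matrix (Fin d) (Fin d) ℝ))
    Units.continuous_embedProduct).comp A

theorem isInducing_cocycleEmbed :
    IsInducing (cocycleEmbed : C(X, GL (Fin d) ℝ) → _) :=
  ContinuousMap.isInducing_postcomp _ Units.isEmbedding_embedProduct.isInducing

theorem dist_cocycleEmbed_le (A B : C(X, GL (Fin d) ℝ)) :
    dist (cocycleEmbed A) (cocycleEmbed B) ≤ cocycleDist A B := by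
  rw [ContinuousMap.dist_le (cocycleDist_nonneg A B)]
  intro x
  have h := le_cocycleDist A B x
  rw [Prod.dist_eq]
  have h1 : dist (cocycleEmbed A x).1 (cocycleEmbed B x).1 =
    ‖(A x : Matrix (Fin d) (Fin d) ℝ) - (B x : Matrix (Fin d) (Fin d) ℝ)‖ := dist_eq_norm _ _
  have h2 : dist (cocycleEmbed A x).2 (cocycleEmbed B x).2 =
    ‖(↑(A x)⁻¹ : Matrix (Fin d) (Fin d) ℝ) - (↑(B x)⁻¹ : Matrix (Fin d) (Fin d) ℝ)‖ :=
    dist_eq_norm (↑(A x)⁻¹ : Matrix (Fin d) (Fin d) ℝ) (↑(B x)⁻¹ : Matrix (Fin d) (Fin d) ℝ)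
  rw [h1, h2]
  refine max_le ?_ ?_
  · linarith [norm_nonneg
      ((↑(A x)⁻¹ : Matrix (Fin d) (Fin d) ℝ) - (↑(B x)⁻¹ : Matrix (Fin d) (Fin d) ℝ))]
  · linarith [norm_nonneg
      ((A x : Matrix (Fin d) (Fin d) ℝ) - (B x : Matrix (Fin d) (Fin d) ℝ))]

theorem cocycleDist_le (A B : C(X, GL (Fin d) ℝ)) :
    cocycleDist A B ≤ 2 * dist (cocycleEmbed A) (cocycleEmbed B) := by
  refine Real.iSup_le (fun x => ?_) (by positivity)
  have h := ContinuousMap.dist_apply_le_dist (f := cocycleEmbed A) (g := cocycleEmbed B) x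
  rw [Prod.dist_eq] at h
  have h1 : dist (cocycleEmbed A x).1 (cocycleEmbed B x).1 =
    ‖(A x : Matrix (Fin d) (Fin d) ℝ) - (B x : Matrix (Fin d) (Fin d) ℝ)‖ := dist_eq_norm _ _
  have h2 : dist (cocycleEmbed A x).2 (cocycleEmbed B x).2 =
    ‖(↑(A x)⁻¹ : Matrix (Fin d) (Fin d) ℝ) - (↑(B x)⁻¹ : Matrix (Fin d) (Fin d) ℝ)‖ :=
    dist_eq_norm (↑(A x)⁻¹ : Matrix (Fin d) (Fin d) ℝ) (↑(B x)⁻¹ : Matrix (Fin d) (Fin d) ℝ)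
  rw [h1, h2] at h
  linarith [(max_le_iff.1 h).1, (max_le_iff.1 h).2]

/-- `ρ` makes `C(X, GL_d(ℝ))` a metric space; its topology is shown here to be the compact-open
topology that Mathlib puts on `C(X, GL_d(ℝ))`, so that the two agree. -/
noncomputable instance cocycleMetricSpace : MetricSpace C(X, GL (Fin d) ℝ) where
  toPseudoMetricSpace := PseudoMetricSpace.ofDistTopology cocycleDist
    (fun A => by simp [cocycleDist])
    (fun A B => by simp only [cocycleDist, norm_sub_rev])
    (fun A B C => by
      refine Real.iSup_le (fun x => ?_)
        (add_nonneg (cocycleDist_nonneg A B) (cocycleDist_nonneg B C))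
      have h1 := le_cocycleDist A B x
      have h2 := le_cocycleDist B C x
      have h3 := norm_sub_le_norm_sub_add_norm_sub (A x : Matrix (Fin d) (Fin d) ℝ)
        (B x : Matrix (Fin d) (Fin d) ℝ) (C x : Matrix (Fin d) (Fin d) ℝ)
      have h4 := norm_sub_le_norm_sub_add_norm_sub (↑(A x)⁻¹ : Matrix (Fin d) (Fin d) ℝ)
        (↑(B x)⁻¹ : Matrix (Fin d) (Fin d) ℝ) (↑(C x)⁻¹ : Matrix (Fin d) (Fin d) ℝ)
      linarith)
    (fun s => by
      rw [isOpen_iff_mem_nhds]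
      refine forall₂_congr fun A _ => ?_
      rw [isInducing_cocycleEmbed.nhds_eq_comap, (Metric.nhds_basis_ball.comap _).mem_iff]
      constructor
      · rintro ⟨ε, hε, h⟩
        refine ⟨ε, hε, fun B hB => h ?_⟩
        rw [Set.mem_preimage, Metric.mem_ball, dist_comm]
        exact (dist_cocycleEmbed_le A B).trans_lt hB
      · rintro ⟨ε, hε, h⟩
        refine ⟨ε / 2, half_pos hε, fun B hB => h B ?_⟩
        rw [Set.mem_preimage, Metric.mem_ball, dist_comm] at hB
        linarith [cocycleDist_le A B])
  eq_of_dist_eq_zero := by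
    intro A B h
    have h0 : cocycleDist A B = 0 := h
    ext1 x
    apply Units.ext
    have h1 := le_cocycleDist A B x
    have h2 := norm_nonneg
      ((↑(A x)⁻¹ : Matrix (Fin d) (Fin d) ℝ) - (↑(B x)⁻¹ : Matrix (Fin d) (Fin d) ℝ))
    have h3 := norm_nonneg
      ((A x : Matrix (Fin d) (Fin d) ℝ) - (B x : Matrix (Fin d) (Fin d) ℝ))
    exact sub_eq_zero.1 (norm_eq_zero.1 (by linarith))

end CocycleMetric

/-- A dynamical system is minimal if every (forward) orbit is dense. -/
def IsMinimalSystem {X : Type*} [TopologicalSpace X] (T : X → X) : Prop :=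
  ∀ x : X, Dense (Set.range fun n : ℕ => T^[n] x)

/-- The set of `T`-invariant ergodic Borel probability measures. -/
def ergodicMeasures {X : Type*} [MeasurableSpace X] (T : X → X) : Set (ProbabilityMeasure X) :=
  {μ | Ergodic T (μ : Measure X)}

/-- `A(n,x) = A(T^{n-1}x) ⋯ A(Tx) A(x)`. -/
def cocycle {X : Type*} [TopologicalSpace X] {d : ℕ} (T : X → X) (A : C(X, GL (Fin d) ℝ)) :
    ℕ → X → GL (Fin d) ℝ
  | 0, _ => 1
  | n + 1, x => A (T^[n] x) * cocycle T A n x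

/-- The set of Lyapunov-irregular points of `A`: the points `x` at which
`(1/n) log ‖A(n,x)‖` does not converge as `n → ∞`. -/
def lyapunovIrregular {X : Type*} [TopologicalSpace X] {d : ℕ} (T : X → X)
    (A : C(X, GL (Fin d) ℝ)) : Set X :=
  {x | ¬ ∃ c : ℝ, Tendsto
    (fun n : ℕ => (1 / (n : ℝ)) * Real.log ‖(cocycle T A n x : Matrix (Fin d) (Fin d) ℝ)‖)
    atTop (𝓝 c)}

/-- The set `𝓡` of all `A` whose Lyapunov-irregular set is residual in `X`. -/
def residuallyIrregular {X : Type*} [TopologicalSpace X] (T : X → X) (d : ℕ) :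
    Set C(X, GL (Fin d) ℝ) :=
  {A | lyapunovIrregular T A ∈ residual X}

/-! Fix two distinct ergodic measures μ, ν. The exponent L_μ(A), the limit of (1/n)∫ log‖A(n,·)‖ dμ,
is a mean, so if L_μ(A) ≠ L_ν(A) then for large n the function (1/n) log‖A(n,·)‖ is low at one point
and high at another. Moving along an orbit changes log‖A(n,·)‖ by an error bounded in n, and
minimality carries every point into any given open set in bounded time, so a generic point sees both
values infinitely often (`mem_residuallyIrregular_of_topExponent_ne`).

It remains to make L_μ ≠ L_ν on a dense open set (`dense_interior_topExponent_ne`). Both exponents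
are infima of continuous functions of A, hence upper semicontinuous, so every open set contains a
point near which both oscillate little. If their gap there is small, multiplying A by the scalar
exp(tφ), where ∫φ dμ ≠ ∫φ dν, opens it and keeps the small oscillation. A dense open subset of the
residually irregular cocycles gives both conclusions. -/

/-! ### Logarithm of the norm and scalar matrices -/

section LogNorm

variable {d : ℕ}

/-- The scalar matrix `e^t`, as an element of `GL_d(ℝ)`. -/
noncomputable def expScalar : C(ℝ, GL (Fin d) ℝ) where
  toFun t :=
    ⟨Real.exp t • 1, Real.exp (-t) • 1, by simp [smul_smul, ← Real.exp_add],
      by simp [smul_smul, ← Real.exp_add]⟩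
  continuous_toFun := by
    refine Units.continuous_iff.2 ⟨?_, ?_⟩
    · exact Real.continuous_exp.smul continuous_const
    · exact (Real.continuous_exp.comp continuous_neg).smul continuous_const

theorem coe_expScalar (t : ℝ) :
    ((expScalar t : GL (Fin d) ℝ) : Matrix (Fin d) (Fin d) ℝ) = Real.exp t • 1 := rfl

theorem expScalar_add (s t : ℝ) :
    (expScalar (s + t) : GL (Fin d) ℝ) = expScalar s * expScalar t := by
  ext1
  simp [coe_expScalar, smul_smul, Real.exp_add, mul_comm]

theorem expScalar_zero : (expScalar 0 : GL (Fin d) ℝ) = 1 := by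
  ext1
  simp [coe_expScalar]

theorem expScalar_mul_comm (t : ℝ) (M : GL (Fin d) ℝ) : expScalar t * M = M * expScalar t := by
  apply Units.ext
  simp [coe_expScalar]

variable [NeZero d]

/-- The function `M ↦ log ‖M‖` on `GL_d(ℝ)`. -/
noncomputable def logNorm : C(GL (Fin d) ℝ, ℝ) where
  toFun M := Real.log ‖(M : Matrix (Fin d) (Fin d) ℝ)‖
  continuous_toFun :=
    (Units.continuous_val.norm).log fun M => (Units.norm_pos M).ne'

theorem logNorm_apply (M : GL (Fin d) ℝ) :
    logNorm M = Real.log ‖(M : Matrix (Fin d) (Fin d) ℝ)‖ := rfl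

theorem logNorm_mul_le (M N : GL (Fin d) ℝ) : logNorm (M * N) ≤ logNorm M + logNorm N := by
  simp only [logNorm_apply]
  rw [← Real.log_mul (Units.norm_pos M).ne' (Units.norm_pos N).ne']
  exact Real.log_le_log (Units.norm_pos _) (norm_mul_le _ _)

theorem logNorm_one : logNorm (1 : GL (Fin d) ℝ) = 0 := by
  simp [logNorm_apply]

theorem logNorm_expScalar_mul (t : ℝ) (M : GL (Fin d) ℝ) :
    logNorm (expScalar t * M) = t + logNorm M := by
  simp only [logNorm_apply, Units.val_mul, coe_expScalar, smul_mul_assoc, one_mul, norm_smul,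
    Real.norm_eq_abs, Real.abs_exp]
  rw [Real.log_mul (Real.exp_pos t).ne' (Units.norm_pos M).ne', Real.log_exp]

end LogNorm

/-! ### Growth of matrix cocycles -/

section Cocycle

variable {X : Type*} [TopologicalSpace X] {d : ℕ}

theorem cocycle_add (T : X → X) (A : C(X, GL (Fin d) ℝ)) (m n : ℕ) (x : X) :
    cocycle T A (m + n) x = cocycle T A m (T^[n] x) * cocycle T A n x := by
  induction m with
  | zero => simp [cocycle]
  | succ m ih =>
    rw [Nat.add_right_comm, cocycle, ih, cocycle, Function.iterate_add_apply, mul_assoc]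

theorem continuous_cocycle {T : X → X} (hT : Continuous T) (A : C(X, GL (Fin d) ℝ)) (n : ℕ) :
    Continuous (cocycle T A n) := by
  induction n with
  | zero => exact continuous_const
  | succ n ih => exact (A.continuous.comp (hT.iterate n)).mul ih

variable [NeZero d]

/-- The function `x ↦ log ‖A(n,x)‖`. -/
noncomputable def logNormCocycle (T : C(X, X)) (A : C(X, GL (Fin d) ℝ)) (n : ℕ) : C(X, ℝ) :=
  logNorm.comp ⟨cocycle T A n, continuous_cocycle T.continuous A n⟩

theorem logNormCocycle_apply (T : C(X, X)) (A : C(X, GL (Fin d) ℝ)) (n : ℕ) (x : X) :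
    logNormCocycle T A n x = logNorm (cocycle T A n x) := rfl

theorem logNormCocycle_add_le (T : C(X, X)) (A : C(X, GL (Fin d) ℝ)) (m n : ℕ) (x : X) :
    logNormCocycle T A (m + n) x ≤ logNormCocycle T A m (T^[n] x) + logNormCocycle T A n x := by
  simp only [logNormCocycle_apply, cocycle_add]
  exact logNorm_mul_le _ _

/-- The function `x ↦ log ‖A(x)⁻¹‖`. -/
noncomputable def logNormInv (A : C(X, GL (Fin d) ℝ)) : C(X, ℝ) := logNorm.comp A⁻¹

/-- Scalar matrices are central, so the factors exp(φ) collect into the exponential of a Birkhoff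
sum. -/
theorem logNormCocycle_smul (T : C(X, X)) (φ : C(X, ℝ)) (A : C(X, GL (Fin d) ℝ)) (n : ℕ) (x : X) :
    logNormCocycle T (expScalar.comp φ * A) n x =
      birkhoffSum T φ n x + logNormCocycle T A n x := by
  have h : cocycle T (expScalar.comp φ * A) n x =
      expScalar (birkhoffSum T φ n x) * cocycle T A n x := by
    induction n with
    | zero => simp [cocycle, expScalar_zero]
    | succ n ih =>
      rw [cocycle, ih, cocycle, birkhoffSum_succ, add_comm, expScalar_add]
      simp only [ContinuousMap.mul_apply, ContinuousMap.comp_apply, mul_assoc]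
      rw [← mul_assoc (A _), ← expScalar_mul_comm, mul_assoc]
  rw [logNormCocycle_apply, h, logNorm_expScalar_mul, logNormCocycle_apply]

/-- Both A(n,T^k x) A(k,x) and A(k,T^n x) A(n,x) equal A(n+k,x). The factors of length k and their
inverses are bounded on X, whatever n is. -/
theorem exists_logNormCocycle_iterate_sub_le [CompactSpace X] (T : C(X, X))
    (A : C(X, GL (Fin d) ℝ)) (k : ℕ) :
    ∃ C : ℝ, ∀ n x, |logNormCocycle T A n (T^[k] x) - logNormCocycle T A n x| ≤ C := by
  let P : C(X, GL (Fin d) ℝ) := ⟨cocycle T A k, continuous_cocycle T.continuous A k⟩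
  refine ⟨‖logNorm.comp P‖ + ‖logNorm.comp P⁻¹‖, fun n x => ?_⟩
  have hP : ∀ y, logNorm (cocycle T A k y) ≤ ‖logNorm.comp P‖ := fun y =>
    (le_abs_self _).trans ((logNorm.comp P).norm_coe_le_norm y)
  have hQ : ∀ y, logNorm (cocycle T A k y)⁻¹ ≤ ‖logNorm.comp P⁻¹‖ := fun y =>
    (le_abs_self _).trans ((logNorm.comp P⁻¹).norm_coe_le_norm y)
  have h : cocycle T A n (T^[k] x) * cocycle T A k x =
      cocycle T A k (T^[n] x) * cocycle T A n x := by
    rw [← cocycle_add, ← cocycle_add, add_comm]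
  have h1 : cocycle T A n (T^[k] x) =
      cocycle T A k (T^[n] x) * cocycle T A n x * (cocycle T A k x)⁻¹ := by
    rw [← h, mul_inv_cancel_right]
  have h2 : cocycle T A n x =
      (cocycle T A k (T^[n] x))⁻¹ * (cocycle T A n (T^[k] x) * cocycle T A k x) := by
    rw [h, inv_mul_cancel_left]
  have h3 : logNorm (cocycle T A n (T^[k] x)) ≤ logNorm (cocycle T A k (T^[n] x)) +
      logNorm (cocycle T A n x) + logNorm (cocycle T A k x)⁻¹ := by
    rw [h1]
    exact (logNorm_mul_le _ _).trans (add_le_add_left (logNorm_mul_le _ _) _)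
  have h4 : logNorm (cocycle T A n x) ≤ logNorm (cocycle T A k (T^[n] x))⁻¹ +
      (logNorm (cocycle T A n (T^[k] x)) + logNorm (cocycle T A k x)) := by
    conv_lhs => rw [h2]
    exact (logNorm_mul_le _ _).trans (add_le_add_right (logNorm_mul_le _ _) _)
  simp only [logNormCocycle_apply]
  rw [abs_sub_le_iff]
  constructor
  · linarith [hP (T^[n] x), hQ x]
  · linarith [hP x, hQ (T^[n] x)]

theorem neg_mul_norm_logNormInv_le [CompactSpace X] (T : C(X, X)) (A : C(X, GL (Fin d) ℝ)) (n : ℕ)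
    (x : X) : -(n * ‖logNormInv A‖) ≤ logNormCocycle T A n x := by
  induction n with
  | zero => simp [logNormCocycle_apply, cocycle, logNorm_one]
  | succ n ih =>
    have h : cocycle T A n x = (A (T^[n] x))⁻¹ * cocycle T A (n + 1) x := by
      rw [cocycle, inv_mul_cancel_left]
    have h1 : logNormCocycle T A n x ≤
        logNormInv A (T^[n] x) + logNormCocycle T A (n + 1) x := by
      rw [logNormCocycle_apply, h]
      exact logNorm_mul_le _ _
    have h2 := (le_abs_self _).trans ((logNormInv A).norm_coe_le_norm (T^[n] x))
    push_cast
    linarith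

theorem continuous_logNormCocycle [CompactSpace X] [LocallyCompactSpace X] (T : C(X, X)) (n : ℕ) :
    Continuous fun A : C(X, GL (Fin d) ℝ) => logNormCocycle T A n := by
  have h : Continuous fun A : C(X, GL (Fin d) ℝ) =>
      (⟨cocycle T A n, continuous_cocycle T.continuous A n⟩ : C(X, GL (Fin d) ℝ)) := by
    induction n with
    | zero =>
      exact (continuous_const : Continuous fun _ : C(X, GL (Fin d) ℝ) => (1 : C(X, GL (Fin d) ℝ)))
    | succ n ih =>
      exact Continuous.mul (f := fun A : C(X, GL (Fin d) ℝ) =>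
        A.comp (⟨T^[n], T.continuous.iterate n⟩ : C(X, X))) (ContinuousMap.continuous_precomp _) ih
  exact (ContinuousMap.continuous_postcomp logNorm).comp h

theorem continuous_logNormInv [CompactSpace X] :
    Continuous fun A : C(X, GL (Fin d) ℝ) => logNormInv A :=
  (ContinuousMap.continuous_postcomp _).comp
    (ContinuousMap.continuous_postcomp ⟨fun M : GL (Fin d) ℝ => M⁻¹, continuous_inv⟩)

end Cocycle

/-! ### From oscillation at scattered points to generic irregularity -/

section Residual

variable {X : Type*} [TopologicalSpace X] [CompactSpace X]

/-- By minimality the sets T^{-k}V cover X; compactness bounds the hitting time uniformly. -/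
theorem IsMinimalSystem.exists_iterate_mem {T : X → X} (hmin : IsMinimalSystem T)
    (hT : Continuous T) {V : Set X} (hV : IsOpen V) (hne : V.Nonempty) :
    ∃ K : Finset ℕ, ∀ x, ∃ k ∈ K, T^[k] x ∈ V := by
  obtain ⟨K, hK⟩ := isCompact_univ.elim_finite_subcover (fun k : ℕ => T^[k] ⁻¹' V)
    (fun k => hV.preimage (hT.iterate k)) fun x _ => by
      obtain ⟨_, hy, k, rfl⟩ := (hmin x).inter_open_nonempty V hV hne
      exact Set.mem_iUnion.2 ⟨k, hy⟩
  refine ⟨K, fun x => ?_⟩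
  simpa using hK (Set.mem_univ x)

/-- If `F n` is almost invariant under a minimal map, uniformly in `n`, then a value of `F n / n`
approached along infinitely many `n` is approached infinitely often at a generic point. -/
theorem IsMinimalSystem.residual_frequently_lt {T : X → X} (hmin : IsMinimalSystem T)
    (hT : Continuous T) {F : ℕ → C(X, ℝ)}
    (hF : ∀ k, ∃ C : ℝ, ∀ n x, |F n (T^[k] x) - F n x| ≤ C) {r s : ℝ} (hrs : r < s)
    (h : ∃ᶠ n : ℕ in atTop, ∃ x, F n x < n * r) :
    ∀ᶠ x in residual X, ∃ᶠ n : ℕ in atTop, F n x < n * s := by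
  simp only [frequently_atTop, eventually_countable_forall]
  intro N
  refine residual_of_dense_open ?_ ?_
  · simp only [Set.ofPred_exists, Set.ofPred_and]
    exact isOpen_iUnion fun n => isOpen_const.inter (isOpen_lt (F n).continuous continuous_const)
  · rw [dense_iff_inter_open]
    intro V hV hne
    obtain ⟨K, hK⟩ := hmin.exists_iterate_mem hT hV hne
    choose C hC using hF
    obtain ⟨M, hM⟩ : ∃ M : ℝ, ∀ k ∈ K, C k ≤ M := by
      obtain ⟨M, hM⟩ := (K.image C).bddAbove
      exact ⟨M, fun k hk => hM (by simpa using ⟨k, hk, rfl⟩)⟩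
    -- The slack between n r and n s eventually absorbs the bounded cost M of moving x into V.
    have hev : ∀ᶠ n : ℕ in atTop, M ≤ n * (s - r) :=
      (tendsto_natCast_atTop_atTop.atTop_mul_const (sub_pos.2 hrs)).eventually_ge_atTop M
    obtain ⟨n, ⟨x, hx⟩, hn, hNn⟩ := (h.and_eventually (hev.and (eventually_ge_atTop N))).exists
    obtain ⟨k, hk, hkV⟩ := hK x
    refine ⟨T^[k] x, hkV, n, hNn, ?_⟩
    have := (le_abs_self _).trans ((hC k n x).trans (hM k hk))
    linarith

theorem not_tendsto_of_frequently_lt_of_frequently_gt {f : ℕ → ℝ} {s t : ℝ} (hst : s < t)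
    (hs : ∃ᶠ n : ℕ in atTop, f n < n * s) (ht : ∃ᶠ n : ℕ in atTop, n * t < f n) :
    ¬ ∃ c : ℝ, Tendsto (fun n : ℕ => (1 / (n : ℝ)) * f n) atTop (𝓝 c) := by
  rintro ⟨c, hc⟩
  have h1 : c ≤ s := by
    refine le_of_tendsto_of_frequently hc ?_
    refine (hs.and_eventually (eventually_gt_atTop 0)).mono fun n hn => ?_
    have hn0 : (0 : ℝ) < n := Nat.cast_pos.2 hn.2
    rw [one_div, inv_mul_le_iff₀ hn0]
    exact hn.1.le
  have h2 : t ≤ c := by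
    refine ge_of_tendsto_of_frequently hc ?_
    refine (ht.and_eventually (eventually_gt_atTop 0)).mono fun n hn => ?_
    have hn0 : (0 : ℝ) < n := Nat.cast_pos.2 hn.2
    rw [one_div, le_inv_mul_iff₀ hn0]
    exact hn.1.le
  exact (hst.trans_le (h2.trans h1)).false

theorem mem_residuallyIrregular {d : ℕ} [NeZero d] (T : C(X, X)) (hmin : IsMinimalSystem T)
    (A : C(X, GL (Fin d) ℝ)) {r s : ℝ} (hrs : r < s)
    (hr : ∃ᶠ n : ℕ in atTop, ∃ x, logNormCocycle T A n x < n * r)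
    (hs : ∃ᶠ n : ℕ in atTop, ∃ x, n * s < logNormCocycle T A n x) :
    A ∈ residuallyIrregular T d := by
  have hF := exists_logNormCocycle_iterate_sub_le T A
  -- Passing to generic points weakens each threshold, so r < u < v < s keeps them apart.
  obtain ⟨u, hru, hus⟩ := exists_between hrs
  obtain ⟨v, huv, hvs⟩ := exists_between hus
  have h1 := hmin.residual_frequently_lt T.continuous hF hru hr
  have h2 := hmin.residual_frequently_lt T.continuous (F := fun n => -logNormCocycle T A n)
    (fun k => (hF k).imp fun C hC n x => by
      have := hC n x
      rw [← abs_neg] at this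
      convert this using 2
      simp only [ContinuousMap.neg_apply]
      ring) (neg_lt_neg hvs)
    (by simpa using hs)
  filter_upwards [h1, h2] with x hx1 hx2
  refine not_tendsto_of_frequently_lt_of_frequently_gt huv hx1 ?_
  simpa [logNormCocycle_apply, logNorm_apply] using hx2

end Residual

theorem MeasureTheory.MeasurePreserving.integral_iterate {X : Type*} [TopologicalSpace X]
    [MeasurableSpace X] [BorelSpace X] {T : X → X} {μ : Measure X}
    (hμ : MeasurePreserving T μ μ) (f : C(X, ℝ)) (n : ℕ) :
    ∫ x, f (T^[n] x) ∂μ = ∫ x, f x ∂μ := by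
  have h := hμ.iterate n
  conv_rhs => rw [← h.map_eq]
  exact (integral_map_of_stronglyMeasurable h.measurable f.continuous.stronglyMeasurable).symm

/-! ### Top Lyapunov exponents of invariant measures -/

section Exponent

variable {X : Type*} [TopologicalSpace X] [CompactSpace X] [MeasurableSpace X] [BorelSpace X]
  {d : ℕ}

theorem ContinuousMap.integrable_of_compactSpace (μ : Measure X) [IsFiniteMeasure μ] (f : C(X, ℝ)) :
    Integrable f μ :=
  f.continuous.integrable_of_hasCompactSupport (HasCompactSupport.of_compactSpace f)

theorem ContinuousMap.continuous_integral (μ : Measure X) [IsFiniteMeasure μ] :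
    Continuous fun f : C(X, ℝ) => ∫ x, f x ∂μ := by
  refine (LipschitzWith.of_dist_le' (K := μ.real Set.univ) fun f g => ?_).continuous
  rw [Real.dist_eq, ← integral_sub (f.integrable_of_compactSpace μ) (g.integrable_of_compactSpace μ),
    mul_comm]
  exact norm_integral_le_of_norm_le_const
    (ae_of_all _ fun x => (dist_eq_norm (f x) (g x)).symm.trans_le (f.dist_apply_le_dist x))

variable [NeZero d]

/-- The integral `∫ log ‖A(n,x)‖ dμ(x)`. -/
noncomputable def integralLogNorm (T : C(X, X)) (μ : Measure X) (A : C(X, GL (Fin d) ℝ)) (n : ℕ) :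
    ℝ :=
  ∫ x, logNormCocycle T A n x ∂μ

/-- The top Lyapunov exponent of `A` with respect to an invariant measure `μ`. -/
noncomputable def topExponent (T : C(X, X)) (μ : Measure X) (A : C(X, GL (Fin d) ℝ)) : ℝ :=
  sInf ((fun n : ℕ => integralLogNorm T μ A n / n) '' Set.Ici 1)

variable {T : C(X, X)} {μ : Measure X} [IsProbabilityMeasure μ]

theorem subadditive_integralLogNorm (hμ : MeasurePreserving T μ μ) (A : C(X, GL (Fin d) ℝ)) :
    Subadditive (integralLogNorm T μ A) := by
  intro m n
  have hi : Integrable (fun x => logNormCocycle T A m (T^[n] x)) μ :=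
    ((logNormCocycle T A m).comp ⟨T^[n], T.continuous.iterate n⟩).integrable_of_compactSpace μ
  have h : ∫ x, logNormCocycle T A m (T^[n] x) ∂μ = integralLogNorm T μ A m :=
    hμ.integral_iterate _ n
  rw [← h, integralLogNorm, integralLogNorm,
    ← integral_add hi ((logNormCocycle T A n).integrable_of_compactSpace μ)]
  exact integral_mono ((logNormCocycle T A (m + n)).integrable_of_compactSpace μ)
    (hi.add ((logNormCocycle T A n).integrable_of_compactSpace μ)) (logNormCocycle_add_le T A m n)

theorem neg_norm_logNormInv_le_integralLogNorm_div (T : C(X, X)) (μ : Measure X)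
    [IsProbabilityMeasure μ] (A : C(X, GL (Fin d) ℝ)) (n : ℕ) :
    -‖logNormInv A‖ ≤ integralLogNorm T μ A n / n := by
  rcases n.eq_zero_or_pos with rfl | hn
  · simp
  · have hn0 : (0 : ℝ) < n := Nat.cast_pos.2 hn
    rw [le_div_iff₀ hn0]
    have h := integral_mono (integrable_const (μ := μ) (-(n * ‖logNormInv A‖)))
      ((logNormCocycle T A n).integrable_of_compactSpace μ) (neg_mul_norm_logNormInv_le T A n)
    rw [integral_const, probReal_univ, one_smul] at h
    rw [integralLogNorm]
    linarith

theorem bddBelow_integralLogNorm_div (T : C(X, X)) (μ : Measure X)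
    [IsProbabilityMeasure μ] (A : C(X, GL (Fin d) ℝ)) :
    BddBelow (Set.range fun n : ℕ => integralLogNorm T μ A n / n) :=
  ⟨_, Set.forall_mem_range.2 (neg_norm_logNormInv_le_integralLogNorm_div T μ A)⟩

/-- Fekete's lemma. The infimum gives semicontinuity in A; the limit gives the effect of scalar
factors and comparison with pointwise values. -/
theorem tendsto_topExponent (hμ : MeasurePreserving T μ μ) (A : C(X, GL (Fin d) ℝ)) :
    Tendsto (fun n : ℕ => integralLogNorm T μ A n / n) atTop (𝓝 (topExponent T μ A)) := by
  have h := (subadditive_integralLogNorm hμ A).tendsto_lim (bddBelow_integralLogNorm_div T μ A)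
  rwa [Subadditive.lim] at h

theorem neg_norm_logNormInv_le_topExponent (T : C(X, X)) (μ : Measure X)
    [IsProbabilityMeasure μ] (A : C(X, GL (Fin d) ℝ)) : -‖logNormInv A‖ ≤ topExponent T μ A :=
  le_csInf (Set.nonempty_Ici.image _) <| Set.forall_mem_image.2 fun _ _ =>
    neg_norm_logNormInv_le_integralLogNorm_div T μ A _

/-- For each n the integral is continuous in A, and an infimum of continuous functions is upper
semicontinuous. -/
theorem upperSemicontinuous_topExponent [LocallyCompactSpace X] (T : C(X, X)) (μ : Measure X)
    [IsProbabilityMeasure μ] :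
    UpperSemicontinuous fun A : C(X, GL (Fin d) ℝ) => topExponent T μ A := by
  intro A c hc
  obtain ⟨_, ⟨n, hn, rfl⟩, hlt⟩ := exists_lt_of_csInf_lt (Set.nonempty_Ici.image _) hc
  have hcont : Continuous fun B : C(X, GL (Fin d) ℝ) => integralLogNorm T μ B n / n :=
    ((ContinuousMap.continuous_integral μ).comp (continuous_logNormCocycle T n)).div_const _
  filter_upwards [hcont.continuousAt.eventually_lt_const hlt] with B hB
  exact (csInf_le ((bddBelow_integralLogNorm_div T μ B).mono (Set.image_subset_range _ _))
    ⟨n, hn, rfl⟩).trans_lt hB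

theorem topExponent_smul (hμ : MeasurePreserving T μ μ) (φ : C(X, ℝ)) (A : C(X, GL (Fin d) ℝ)) :
    topExponent T μ (expScalar.comp φ * A) = ∫ x, φ x ∂μ + topExponent T μ A := by
  refine tendsto_nhds_unique (tendsto_topExponent hμ _)
    (((tendsto_topExponent hμ A).const_add _).congr' ?_)
  filter_upwards [eventually_gt_atTop 0] with n hn
  have hn0 : (n : ℝ) ≠ 0 := (Nat.cast_pos.2 hn).ne'
  have hi : ∀ k ∈ Finset.range n, Integrable (fun x => φ (T^[k] x)) μ := fun k _ =>
    (φ.comp ⟨T^[k], T.continuous.iterate k⟩).integrable_of_compactSpace μ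
  have h : integralLogNorm T μ (expScalar.comp φ * A) n =
      n * ∫ x, φ x ∂μ + integralLogNorm T μ A n := by
    simp only [integralLogNorm, logNormCocycle_smul, birkhoffSum]
    rw [integral_add (integrable_finsetSum _ hi)
      ((logNormCocycle T A n).integrable_of_compactSpace μ), integral_finsetSum _ hi]
    simp [hμ.integral_iterate]
  rw [h]
  field_simp

theorem frequently_exists_logNormCocycle_lt (hμ : MeasurePreserving T μ μ)
    (A : C(X, GL (Fin d) ℝ)) {r : ℝ} (hr : topExponent T μ A < r) :
    ∃ᶠ n : ℕ in atTop, ∃ x, logNormCocycle T A n x < n * r := by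
  refine Eventually.frequently ?_
  filter_upwards [(tendsto_topExponent hμ A).eventually_lt_const hr, eventually_gt_atTop 0]
    with n hn hpos
  by_contra! hcon
  have h := integral_mono (integrable_const (μ := μ) (n * r))
    ((logNormCocycle T A n).integrable_of_compactSpace μ) hcon
  rw [integral_const, probReal_univ, one_smul] at h
  rw [div_lt_iff₀ (Nat.cast_pos.2 hpos), integralLogNorm] at hn
  linarith

theorem frequently_exists_lt_logNormCocycle (hμ : MeasurePreserving T μ μ)
    (A : C(X, GL (Fin d) ℝ)) {r : ℝ} (hr : r < topExponent T μ A) :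
    ∃ᶠ n : ℕ in atTop, ∃ x, n * r < logNormCocycle T A n x := by
  refine Eventually.frequently ?_
  filter_upwards [(tendsto_topExponent hμ A).eventually_const_lt hr, eventually_gt_atTop 0]
    with n hn hpos
  by_contra! hcon
  have h := integral_mono ((logNormCocycle T A n).integrable_of_compactSpace μ)
    (integrable_const (μ := μ) (n * r)) hcon
  rw [integral_const, probReal_univ, one_smul] at h
  rw [lt_div_iff₀ (Nat.cast_pos.2 hpos), integralLogNorm] at hn
  linarith

theorem mem_residuallyIrregular_of_topExponent_ne (hmin : IsMinimalSystem T) {ν : Measure X}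
    [IsProbabilityMeasure ν] (hμ : MeasurePreserving T μ μ) (hν : MeasurePreserving T ν ν)
    {A : C(X, GL (Fin d) ℝ)} (h : topExponent T μ A ≠ topExponent T ν A) :
    A ∈ residuallyIrregular T d := by
  wlog hlt : topExponent T μ A < topExponent T ν A generalizing μ ν
  · exact this hν hμ h.symm (h.symm.lt_of_le (not_lt.1 hlt))
  obtain ⟨r, hr, hr'⟩ := exists_between hlt
  obtain ⟨s, hrs, hs⟩ := exists_between hr'
  exact mem_residuallyIrregular T hmin A hrs (frequently_exists_logNormCocycle_lt hμ A hr)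
    (frequently_exists_lt_logNormCocycle hν A hs)

end Exponent

/-- Near a suitable point of a nonempty open set, two upper semicontinuous functions that are
bounded below oscillate by at most `2 * δ`. -/
theorem exists_eventually_abs_sub_le_of_upperSemicontinuous {Y : Type*} [TopologicalSpace Y]
    {f g : Y → ℝ} (hf : UpperSemicontinuous f) (hg : UpperSemicontinuous g) {U : Set Y}
    (hU : IsOpen U) (hne : U.Nonempty) {m : ℝ} (hfm : ∀ y ∈ U, m ≤ f y) (hgm : ∀ y ∈ U, m ≤ g y)
    {δ : ℝ} (hδ : 0 < δ) :
    ∃ y ∈ U, ∀ᶠ z in 𝓝 y, |f z - f y| ≤ 2 * δ ∧ |g z - g y| ≤ 2 * δ := by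
  have hbdd : BddBelow ((fun y => f y + g y) '' U) :=
    ⟨m + m, Set.forall_mem_image.2 fun y hy => add_le_add (hfm y hy) (hgm y hy)⟩
  -- Take y nearly minimizing f + g. Nearby neither function rises by δ and the sum cannot fall by
  -- δ, so neither falls by 2δ.
  obtain ⟨_, ⟨y, hy, rfl⟩, hlt⟩ :=
    exists_lt_of_csInf_lt (hne.image _) (lt_add_of_pos_right (sInf ((fun y => f y + g y) '' U)) hδ)
  refine ⟨y, hy, ?_⟩
  filter_upwards [hU.mem_nhds hy, hf y (f y + δ) (by linarith), hg y (g y + δ) (by linarith)]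
    with z hz hfz hgz
  have h := csInf_le hbdd ⟨z, hz, rfl⟩
  simp only at h hlt
  exact ⟨abs_le.2 ⟨by linarith, by linarith⟩, abs_le.2 ⟨by linarith, by linarith⟩⟩

/-! ### Separating two exponents on a dense open set -/

section Generic

variable {X : Type*} [TopologicalSpace X] [CompactSpace X] [LocallyCompactSpace X]
  [MeasurableSpace X] [BorelSpace X] {d : ℕ} [NeZero d]

theorem dense_interior_topExponent_ne {T : C(X, X)} {μ ν : Measure X} [IsProbabilityMeasure μ]
    [IsProbabilityMeasure ν] (hμ : MeasurePreserving T μ μ) (hν : MeasurePreserving T ν ν)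
    {φ : C(X, ℝ)} (hφ : ∫ x, φ x ∂μ ≠ ∫ x, φ x ∂ν) :
    Dense (interior {A : C(X, GL (Fin d) ℝ) | topExponent T μ A ≠ topExponent T ν A}) := by
  let S : ℝ → C(X, GL (Fin d) ℝ) := fun t => expScalar.comp (t • φ)
  have hScont : Continuous S :=
    (ContinuousMap.continuous_postcomp _).comp (continuous_id.smul continuous_const)
  have hSinv : ∀ t, S t * S (-t) = 1 := fun t => by
    ext1 x
    simp [S, ← expScalar_add, expScalar_zero]
  have hexp : ∀ (ρ : Measure X) [IsProbabilityMeasure ρ], MeasurePreserving T ρ ρ → ∀ t A,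
      topExponent T ρ (S t * A) = t * ∫ x, φ x ∂ρ + topExponent T ρ A := fun ρ _ hρ t A => by
    rw [topExponent_smul hρ]
    simp [integral_const_mul]
  rw [dense_iff_inter_open]
  rintro U hU ⟨A₀, hA₀⟩
  have hSmul : Continuous fun p : ℝ × C(X, GL (Fin d) ℝ) => S p.1 * p.2 :=
    (hScont.comp continuous_fst).mul continuous_snd
  have hnear : ∀ᶠ p : ℝ × C(X, GL (Fin d) ℝ) in 𝓝 0 ×ˢ 𝓝 A₀, S p.1 * p.2 ∈ U := by
    rw [← nhds_prod_eq]
    refine hSmul.continuousAt.eventually_mem (hU.mem_nhds ?_)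
    have h0 : S 0 = 1 := by
      ext1 x
      simp [S, expScalar_zero]
    simpa [h0] using hA₀
  obtain ⟨p, hp, q, hq, hpq⟩ := eventually_prod_iff.1 hnear
  -- Here t is fixed before B is chosen: it works for all A near A₀, so δ may depend on it.
  obtain ⟨t, htpos, ht⟩ : ∃ t : ℝ, 0 < t ∧ p t :=
    ((eventually_mem_nhdsWithin (a := (0 : ℝ)) (s := Set.Ioi 0)).and
      (hp.filter_mono nhdsWithin_le_nhds)).exists
  have hbdd : ∀ᶠ A in 𝓝 A₀, ‖logNormInv A‖ < ‖logNormInv A₀‖ + 1 :=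
    continuous_logNormInv.norm.continuousAt.eventually_lt_const (lt_add_one _)
  obtain ⟨W, hW, hWo, hWA⟩ := eventually_nhds_iff.1 (hq.and (hbdd.and (hU.eventually_mem hA₀)))
  -- The shift by `S t` changes the difference of exponents by 16δ. A gap of at most 4δ at B plus
  -- oscillations of 2δ for each exponent cancels at most 8δ.
  obtain ⟨δ, hδ⟩ : ∃ δ : ℝ, δ = t * |∫ x, φ x ∂μ - ∫ x, φ x ∂ν| / 16 := ⟨_, rfl⟩
  have hδ0 : 0 < δ := by
    rw [hδ]
    have := abs_pos.2 (sub_ne_zero.2 hφ)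
    positivity
  obtain ⟨B, hBW, hB⟩ := exists_eventually_abs_sub_le_of_upperSemicontinuous
    (upperSemicontinuous_topExponent T μ) (upperSemicontinuous_topExponent T ν) hWo ⟨A₀, hWA⟩
    (m := -(‖logNormInv A₀‖ + 1))
    (fun A hA => (neg_le_neg (hW A hA).2.1.le).trans (neg_norm_logNormInv_le_topExponent T μ A))
    (fun A hA => (neg_le_neg (hW A hA).2.1.le).trans (neg_norm_logNormInv_le_topExponent T ν A))
    hδ0
  by_cases hgap : 4 * δ < |topExponent T μ B - topExponent T ν B|
  · refine ⟨B, (hW B hBW).2.2, mem_interior_iff_mem_nhds.2 ?_⟩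
    filter_upwards [hB] with A hA heq
    refine hgap.not_ge ?_
    have h1 := abs_le.1 hA.1
    have h2 := abs_le.1 hA.2
    exact abs_le.2 ⟨by linarith, by linarith⟩
  · refine ⟨S t * B, hpq ht (hW B hBW).1, mem_interior_iff_mem_nhds.2 ?_⟩
    -- Matrices near `S t * B` are `S t` times matrices near B, so the oscillation bound at B
    -- applies there.
    have hback : Tendsto (fun A => S (-t) * A) (𝓝 (S t * B)) (𝓝 B) := by
      have h : Continuous fun A => S (-t) * A := continuous_const.mul continuous_id
      convert h.tendsto (S t * B) using 2
      have h' := hSinv (-t)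
      rw [neg_neg] at h'
      rw [← mul_assoc, h', one_mul]
    filter_upwards [hback.eventually hB] with A hA heq
    have hA' : S t * (S (-t) * A) = A := by rw [← mul_assoc, hSinv, one_mul]
    rw [← hA', hexp μ hμ, hexp ν hν] at heq
    have h1 := abs_le.1 hA.1
    have h2 := abs_le.1 hA.2
    have h3 := abs_le.1 (not_lt.1 hgap)
    have h4 : t * |∫ x, φ x ∂μ - ∫ x, φ x ∂ν| ≤ 8 * δ := by
      rw [← abs_of_pos htpos, ← abs_mul]
      exact abs_le.2 ⟨by linarith, by linarith⟩
    linarith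

end Generic

theorem exists_continuousMap_integral_ne {X : Type*} [MetricSpace X] [CompactSpace X]
    [MeasurableSpace X] [BorelSpace X] {μ ν : Measure X} [IsFiniteMeasure μ] [IsFiniteMeasure ν]
    (h : μ ≠ ν) : ∃ φ : C(X, ℝ), ∫ x, φ x ∂μ ≠ ∫ x, φ x ∂ν := by
  by_contra! hcon
  exact h (ext_of_forall_integral_eq_of_IsFiniteMeasure fun f => hcon f.toContinuousMap)

theorem corollaryC {X : Type*} [MetricSpace X] [CompactSpace X] [MeasurableSpace X] [BorelSpace X]
    (T : X → X) (hT : Continuous T) (hmin : IsMinimalSystem T)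
    (herg : 1 < (ergodicMeasures T).encard) (d : ℕ) (hd : 1 ≤ d) :
    residuallyIrregular T d ∈ residual C(X, GL (Fin d) ℝ) ∧
      ((ergodicMeasures T).Finite → IsNowhereDense (residuallyIrregular T d)ᶜ) := by
  have : NeZero d := ⟨by omega⟩
  obtain ⟨μ, ν, hμ, hν, hne⟩ := Set.one_lt_encard_iff.1 herg
  have hne' : (μ : Measure X) ≠ ν := fun h => hne (Subtype.ext h)
  obtain ⟨φ, hφ⟩ := exists_continuousMap_integral_ne hne'
  have hμT : MeasurePreserving T (μ : Measure X) μ := Ergodic.toMeasurePreserving hμ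
  have hνT : MeasurePreserving T (ν : Measure X) ν := Ergodic.toMeasurePreserving hν
  have hsub : {A : C(X, GL (Fin d) ℝ) | topExponent ⟨T, hT⟩ (μ : Measure X) A ≠
      topExponent ⟨T, hT⟩ (ν : Measure X) A} ⊆ residuallyIrregular T d := fun A hA =>
    mem_residuallyIrregular_of_topExponent_ne (T := ⟨T, hT⟩) hmin hμT hνT hA
  have hdense : Dense (interior (residuallyIrregular T d)) :=
    (dense_interior_topExponent_ne (T := ⟨T, hT⟩) hμT hνT hφ).mono (interior_mono hsub)
  refine ⟨mem_of_superset (residual_of_dense_open isOpen_interior hdense) interior_subset,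
    fun _ => ?_⟩
  rw [IsNowhereDense, closure_compl, interior_compl, hdense.closure_eq, Set.compl_univ]
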